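/- Let $p$ be a prime and let $m,n,s$ be positive integers. Let $\alpha_0\in\mathbb{F}_{p^m}$ be nonzero such that $x^n-\alpha_0$ is irreducible over $\mathbb{F}_{p^m}$, and put $\alpha=\alpha_0^{p^s}$, $N=np^s$. A linear code $\mathcal{C}\subseteq\mathbb{F}_{p^m}^{N}$ is $\alpha$-constacyclic if it is mapped onto itself by $(c_0,\dots,c_{N-1})\mapsto(\alpha c_{N-1},c_0,\dots,c_{N-2})$; it is nontrivial if $\mathcal{C}\neq 0$ and $\mathcal{C}\neq\mathbb{F}_{p^m}^N$. The symbol-pair distance of two words is $d_{sp}(c,c')=|\{i:(c_i,c_{i+1})\ne(c'_i,c'_{i+1})\}|$ (indices modulo $N$), and $d_{sp}(\mathcal{C})$ is its minimum over pairs of distinct codewords. The code $\mathcal{C}$ is an MDS symbol-pair code if $|\mathcal{C}|=p^{m(N-d_{sp}(\mathcal{C})+2)}$. Words $c$ are identified with the classes of $\sum_i c_ix^i$ in $\mathbb{F}_{p^m}[x]/\langle x^N-\alpha\rangle$. Then every nontrivial MDS symbol-pair $\alpha$-constacyclic code of length $np^s$ over $\mathbb{F}_{p^m}$ is one of the codes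 $\langle g(x)\rangle$ in the following table; conversely, every code in the table (for the given $n$) is a nontrivial MDS symbol-pair $\alpha$-constacyclic code with the indicated dimension and symbol-pair distance. In particular, no nontrivial MDS symbol-pair $\alpha$-constacyclic code exists for $n\ge 3$. $$\begin{array}{|c|l|c|c|l|} \hline n & g(x) & \text{dimension} & d_{sp} & \text{condition}\\ \hline 1 & x-\alpha_0 & p^s-1 & 3 & p^s\ge 3\\ 1 & (x-\alpha_0)^2 & p^s-2 & 4 & p^s\ge 4\\ 1 & (x-\alpha_0)^4 & 5 & 6 & p=3,\ s=2\\ 1 & (x-\alpha_0)^k & p-k & k+2 & s=1,\ 1\le k\le p-2\\ 1 & (x-\alpha_0)^{p^s-2} & 2 & p^s & p^s\ge 3\\ 2 & x^2-\alpha_0 & 2p^s-2 & 4 & \\ 2 & (x^2-\alpha_0)^k & 2p-2k & 2k+2 & s=1,\ 1\le k\le p-2\\ 2 & (x^2-\alpha_0)^{p^s-1} & 2 & 2p^s & \\ \hline \end{array}$$ -/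

import Mathlib

open Polynomial

/-- The symbol-pair vector `((x₀, x₁), (x₁, x₂), …, (x_{N-1}, x₀))` of `x`;
`finRotate N` is the cyclic successor `i ↦ i + 1` modulo `N`. -/
def pairVector {A : Type*} {N : ℕ} (x : Fin N → A) : Fin N → A × A :=
  fun i => (x i, x (finRotate N i))

/-- The symbol-pair distance of two words: the Hamming distance of their symbol-pair vectors. -/
noncomputable def pairDist {A : Type*} {N : ℕ} (x y : Fin N → A) : ℕ :=
  letI := Classical.decEq A
  hammingDist (pairVector x) (pairVector y)

/-- The minimum symbol-pair distance of a code (equal to `0` for a code with at most one word). -/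
noncomputable def minPairDist {A : Type*} {N : ℕ} (K : Set (Fin N → A)) : ℕ :=
  sInf {d | ∃ x ∈ K, ∃ y ∈ K, x ≠ y ∧ pairDist x y = d}

/-- A code meeting the Singleton bound for symbol-pair codes, `|K| = q ^ (N - d + 2)`.
Always `d ≤ N`, so the subtraction is not truncated. -/
def IsPairMDS {A : Type*} {N : ℕ} (K : Set (Fin N → A)) : Prop :=
  Nat.card K = Nat.card A ^ (N - minPairDist K + 2)

/-- The constacyclic shift `(x₀, …, x_{N-1}) ↦ (a x_{N-1}, x₀, …, x_{N-2})`. -/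
def constaShift {F : Type*} [Field F] {N : ℕ} (a : F) (x : Fin N → F) : Fin N → F :=
  fun i => if (i : ℕ) = 0 then a * x ((finRotate N).symm i) else x ((finRotate N).symm i)

/-- An `a`-constacyclic (linear) code. -/
def IsConstacyclic {F : Type*} [Field F] {N : ℕ} (a : F) (K : Submodule F (Fin N → F)) : Prop :=
  constaShift a '' (K : Set (Fin N → F)) = K

/-- The polynomial representation `c₀ + c₁ x + ⋯ + c_{N-1} x^{N-1}` of a word, in
`F[x] / ⟨x^N - a⟩`. -/
noncomputable def polyRep {F : Type*} [Field F] (N : ℕ) (a : F) :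
    (Fin N → F) →ₗ[F] (F[X] ⧸ Ideal.span {(X ^ N - C a : F[X])}) where
  toFun c := Ideal.Quotient.mk _ (∑ i : Fin N, C (c i) * X ^ (i : ℕ))
  map_add' c d := by
    rw [← map_add, ← Finset.sum_add_distrib]
    simp only [Pi.add_apply, C_add, add_mul]
  map_smul' r c := by
    rw [RingHom.id_apply, ← Ideal.Quotient.mkₐ_eq_mk F, ← map_smul, Finset.smul_sum]
    simp only [Pi.smul_apply, smul_eq_mul, C_mul, smul_eq_C_mul, mul_assoc]

/-- The code of length `N` that corresponds to the ideal `⟨g⟩` of `F[x] / ⟨x^N - a⟩`. -/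
noncomputable def constaCode {F : Type*} [Field F] (N : ℕ) (a : F) (g : F[X]) :
    Submodule F (Fin N → F) :=
  ((Ideal.span {Ideal.Quotient.mk (Ideal.span {(X ^ N - C a : F[X])}) g}).restrictScalars F).comap
    (polyRep N a)

/-- The list of codes of length `n p ^ s`: `PairMDSTable p s α₀ n g k d` says that there is a row
with the given `n`, generator polynomial `g`, dimension `k` and symbol-pair distance `d`. -/
inductive PairMDSTable {F : Type*} [Field F] (p s : ℕ) (α₀ : F) : ℕ → F[X] → ℕ → ℕ → Prop
  | row1 (h : 3 ≤ p ^ s) : PairMDSTable p s α₀ 1 (X - C α₀) (p ^ s - 1) 3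
  | row2 (h : 4 ≤ p ^ s) : PairMDSTable p s α₀ 1 ((X - C α₀) ^ 2) (p ^ s - 2) 4
  | row3 (hp : p = 3) (hs : s = 2) : PairMDSTable p s α₀ 1 ((X - C α₀) ^ 4) 5 6
  | row4 (k : ℕ) (hs : s = 1) (hk : 1 ≤ k) (hk' : k ≤ p - 2) :
      PairMDSTable p s α₀ 1 ((X - C α₀) ^ k) (p - k) (k + 2)
  | row5 (h : 3 ≤ p ^ s) : PairMDSTable p s α₀ 1 ((X - C α₀) ^ (p ^ s - 2)) 2 (p ^ s)
  | row6 : PairMDSTable p s α₀ 2 (X ^ 2 - C α₀) (2 * p ^ s - 2) 4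
  | row7 (k : ℕ) (hs : s = 1) (hk : 1 ≤ k) (hk' : k ≤ p - 2) :
      PairMDSTable p s α₀ 2 ((X ^ 2 - C α₀) ^ k) (2 * p - 2 * k) (2 * k + 2)
  | row8 : PairMDSTable p s α₀ 2 ((X ^ 2 - C α₀) ^ (p ^ s - 1)) 2 (2 * p ^ s)

/-! In characteristic `p`, `X ^ N - α = (X ^ n - α₀) ^ p ^ s`, and `X ^ n - α₀` is irreducible.
Hence every nontrivial constacyclic code is generated by some `(X ^ n - α₀) ^ i` with `0 < i < p ^
s`. Its dimension is `n (p ^ s - i)`, so it is MDS exactly when its pair distance is `n i + 2`, the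
pair weight of an interval of `n i + 1` positions.

Non-MDS codes are excluded by sparse codewords. The generator has at most `i + 1` terms, so the
distance is at most `2 (i + 1)` and `n ≤ 2`. For `n ≤ 2`, the multiples `(X ^ n - α₀) ^ (p ^ e c +
v)`, which Frobenius makes sparse, leave only the table (`minPairDist_lt_of_two`,
`exceptional_of_minPairDist`).

The rows need lower bounds. For `s = 1` a derivative argument bounds the Hamming weight
(`lt_card_support_of_pow_dvd`); for `n = 2` it is applied to even and odd parts separately
(`two_mul_le_card_pairSupport`). In dimension two, two adjacent zeros force a word to vanish. Length
9 is settled by listing the supports of small pair weight. -/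

/-! ### Words and polynomials -/

section Words

variable {F : Type*} [Field F] {N : ℕ}

/-- The polynomial `c₀ + c₁ X + ⋯ + c_{N-1} X^{N-1}` of a word. -/
noncomputable def wordPoly (c : Fin N → F) : F[X] := ∑ i : Fin N, C (c i) * X ^ (i : ℕ)

/-- The word of the first `N` coefficients of a polynomial. -/
def polyWord (N : ℕ) : F[X] →ₗ[F] (Fin N → F) where
  toFun f i := f.coeff i
  map_add' f g := by ext; simp
  map_smul' r f := by ext; simp

@[simp] lemma polyWord_apply (f : F[X]) (i : Fin N) : polyWord N f i = f.coeff i := rfl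

lemma wordPoly_coeff (c : Fin N → F) (j : ℕ) :
    (wordPoly c).coeff j = if h : j < N then c ⟨j, h⟩ else 0 := by
  simp only [wordPoly, finsetSum_coeff, coeff_C_mul, coeff_X_pow]
  split_ifs with h
  · rw [Finset.sum_eq_single ⟨j, h⟩]
    · simp
    · intro b _ hb
      have : j ≠ b := fun e => hb (Fin.ext e.symm)
      simp [this]
    · simp
  · refine Finset.sum_eq_zero fun i _ => ?_
    have : j ≠ i := by have := i.2; omega
    simp [this]

@[simp] lemma wordPoly_coeff_fin (c : Fin N → F) (i : Fin N) : (wordPoly c).coeff i = c i := by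
  simp [wordPoly_coeff]

@[simp] lemma polyWord_wordPoly (c : Fin N → F) : polyWord N (wordPoly c) = c := by
  ext i; simp

lemma degree_wordPoly_lt (c : Fin N → F) : (wordPoly c).degree < N := by
  rw [degree_lt_iff_coeff_zero]
  intro j hj
  simp [wordPoly_coeff, not_lt.2 hj]

lemma wordPoly_polyWord {f : F[X]} (hf : f.degree < N) : wordPoly (polyWord N f) = f := by
  ext j
  rw [wordPoly_coeff]
  split_ifs with h
  · rfl
  · exact ((degree_lt_iff_coeff_zero f N).1 hf j (not_lt.1 h)).symm

@[simp] lemma wordPoly_zero : wordPoly (0 : Fin N → F) = 0 := by simp [wordPoly]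

@[simp] lemma wordPoly_eq_zero {c : Fin N → F} : wordPoly c = 0 ↔ c = 0 := by
  constructor
  · intro h
    rw [← polyWord_wordPoly c, h, map_zero]
  · rintro rfl; simp

lemma mem_constaCode {a : F} {g : F[X]} (hg : g ∣ X ^ N - C a) {c : Fin N → F} :
    c ∈ constaCode N a g ↔ g ∣ wordPoly c := by
  have h1 : c ∈ constaCode N a g ↔
      Ideal.Quotient.mk (Ideal.span {(X ^ N - C a : F[X])}) (wordPoly c) ∈
        Ideal.span {Ideal.Quotient.mk (Ideal.span {(X ^ N - C a : F[X])}) g} := Iff.rfl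
  rw [h1, Ideal.mem_span_singleton, dvd_def]
  constructor
  · rintro ⟨q, hq⟩
    obtain ⟨q, rfl⟩ := Ideal.Quotient.mk_surjective q
    rw [← map_mul, Ideal.Quotient.eq, Ideal.mem_span_singleton] at hq
    exact (dvd_sub_left (dvd_mul_right g q)).1 (hg.trans hq)
  · rintro ⟨q, hq⟩
    exact ⟨Ideal.Quotient.mk _ q, by rw [hq, map_mul]⟩

lemma polyWord_mem_constaCode {a : F} {g f : F[X]} (hg : g ∣ X ^ N - C a) (hf : f.degree < N)
    (hgf : g ∣ f) : polyWord N f ∈ constaCode N a g := by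
  rwa [mem_constaCode hg, wordPoly_polyWord hf]

lemma polyWord_ne_zero {f : F[X]} (hf : f.degree < N) (h0 : f ≠ 0) : polyWord N f ≠ 0 := by
  rwa [← wordPoly_polyWord hf, Ne, wordPoly_eq_zero] at h0

lemma finrank_constaCode {a : F} {g : F[X]} (hg : g ∣ X ^ N - C a) (hg0 : g ≠ 0)
    (hgN : g.natDegree ≤ N) :
    Module.finrank F (constaCode N a g) = N - g.natDegree := by
  have hdeg : ∀ f : F[X], f.degree < ((N - g.natDegree : ℕ) : WithBot ℕ) ↔
      (g * f).degree < N := by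
    intro f
    by_cases hf : f = 0
    · simp [hf]
    · have hgf := mul_ne_zero hg0 hf
      rw [← natDegree_lt_iff_degree_lt hf, ← natDegree_lt_iff_degree_lt hgf,
        natDegree_mul hg0 hf]
      omega
  let φ : degreeLT F (N - g.natDegree) →ₗ[F] (Fin N → F) :=
    (polyWord N) ∘ₗ (LinearMap.mulLeft F g) ∘ₗ (degreeLT F (N - g.natDegree)).subtype
  have hφ : Function.Injective φ := by
    rw [injective_iff_map_eq_zero]
    rintro ⟨f, hf⟩ h
    rw [mem_degreeLT, hdeg] at hf
    have h' : polyWord N (g * f) = 0 := h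
    have h2 : g * f = 0 := by rw [← wordPoly_polyWord hf, h', wordPoly_zero]
    simpa [hg0] using h2
  have hr : LinearMap.range φ = constaCode N a g := by
    ext c
    rw [mem_constaCode hg]
    constructor
    · rintro ⟨⟨f, hf⟩, rfl⟩
      rw [mem_degreeLT, hdeg] at hf
      change g ∣ wordPoly (polyWord N (g * f))
      rw [wordPoly_polyWord hf]
      exact dvd_mul_right _ _
    · rintro ⟨q, hq⟩
      refine ⟨⟨q, ?_⟩, ?_⟩
      · rw [mem_degreeLT, hdeg, ← hq]
        exact degree_wordPoly_lt c
      · change polyWord N (g * q) = c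
        rw [← hq, polyWord_wordPoly]
  rw [← hr, LinearMap.finrank_range_of_inj hφ, (degreeLTEquiv F _).finrank_eq,
    Module.finrank_fin_fun]

/-! ### Constacyclic shifts -/

lemma constaShift_apply [NeZero N] (a : F) (x : Fin N → F) (i : Fin N) :
    constaShift a x i = (if i = 0 then a else 1) * x (i - 1) := by
  have : ((i : ℕ) = 0) ↔ i = 0 := by rw [Fin.ext_iff]; rfl
  simp only [constaShift, finRotate_symm_apply, this]
  split_ifs <;> simp

lemma wordPoly_constaShift [NeZero N] (a : F) (x : Fin N → F) :
    wordPoly (constaShift a x) =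
      X * wordPoly x - C (x (Fin.ofNat N (N - 1))) * (X ^ N - C a) := by
  have hN : N ≠ 0 := NeZero.ne N
  ext j
  rcases j with _ | j
  · have h0 : (⟨0, Nat.pos_of_ne_zero hN⟩ : Fin N) = 0 := rfl
    have h1 : (0 : Fin N) - 1 = Fin.ofNat N (N - 1) := by
      rw [sub_eq_iff_eq_add]
      apply Fin.ext
      rcases N with _ | N
      · exact absurd rfl hN
      rcases N with _ | N
      · simp
      · simp
    simp [wordPoly_coeff, Nat.pos_of_ne_zero hN, constaShift_apply, coeff_X_pow, hN.symm, h0,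
      h1, mul_comm]
  · rw [coeff_sub, coeff_X_mul, coeff_C_mul, coeff_sub, coeff_X_pow, coeff_C, wordPoly_coeff,
      wordPoly_coeff]
    by_cases h : j + 1 < N
    · have h0 : (⟨j + 1, h⟩ : Fin N) ≠ 0 := by
        rw [Ne, Fin.ext_iff]
        exact Nat.succ_ne_zero j
      have h1 : (⟨j + 1, h⟩ : Fin N) - 1 = ⟨j, by omega⟩ := by
        rw [sub_eq_iff_eq_add]
        apply Fin.ext
        rw [Fin.val_add, Fin.val_one', Nat.add_mod_mod]
        exact (Nat.mod_eq_of_lt h).symm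
      have h2 : j + 1 ≠ N := h.ne
      simp [h, constaShift_apply, h0, h1, h2, (Nat.lt_succ_self j).trans h]
    · by_cases h3 : j + 1 = N
      · have h4 : j < N := by omega
        have h5 : (⟨j, h4⟩ : Fin N) = Fin.ofNat N (N - 1) := by
          apply Fin.ext
          simp [← h3]
        simp [h3, h4, h5, hN]
      · have h4 : ¬ j < N := by omega
        simp [h, h3, h4]

lemma constaShift_mem_constaCode [NeZero N] {a : F} {g : F[X]} (hg : g ∣ X ^ N - C a)
    {x : Fin N → F} (hx : x ∈ constaCode N a g) : constaShift a x ∈ constaCode N a g := by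
  rw [mem_constaCode hg] at hx ⊢
  rw [wordPoly_constaShift]
  exact dvd_sub (hx.mul_left _) (hg.mul_left _)

lemma constaShift_injective [NeZero N] {a : F} (ha : a ≠ 0) :
    Function.Injective (constaShift a : (Fin N → F) → Fin N → F) := by
  intro x y h
  ext i
  have h1 := congrFun h (i + 1)
  simp only [constaShift_apply, add_sub_cancel_right] at h1
  refine mul_left_cancel₀ ?_ h1
  split_ifs
  · exact ha
  · exact one_ne_zero

/-- The shift maps the code into itself, and an injective self-map of a finite set is onto. -/
lemma isConstacyclic_constaCode [Finite F] [NeZero N] {a : F} (ha : a ≠ 0) {g : F[X]}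
    (hg : g ∣ X ^ N - C a) : IsConstacyclic a (constaCode N a g) := by
  refine Set.eq_of_subset_of_ncard_le ?_ ?_ (Set.toFinite _)
  · rintro _ ⟨x, hx, rfl⟩
    exact constaShift_mem_constaCode hg hx
  · rw [Set.ncard_image_of_injective _ (constaShift_injective ha)]

lemma IsConstacyclic.constaShift_mem {a : F} {K : Submodule F (Fin N → F)}
    (hK : IsConstacyclic a K) {x : Fin N → F} (hx : x ∈ K) : constaShift a x ∈ K :=
  Eq.subset (a := constaShift a '' (K : Set (Fin N → F))) hK (Set.mem_image_of_mem _ hx)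

/-- Iterating the shift translates the support of a word cyclically. -/
lemma IsConstacyclic.exists_translate [NeZero N] {a : F} (ha : a ≠ 0)
    {K : Submodule F (Fin N → F)} (hK : IsConstacyclic a K) {x : Fin N → F} (hx : x ∈ K)
    (k : Fin N) : ∃ y ∈ K, ∀ i, y i ≠ 0 ↔ x (i - k) ≠ 0 := by
  have key : ∀ k : ℕ, ∃ y ∈ K, ∀ i, y i ≠ 0 ↔ x (i - (Fin.ofNat N k)) ≠ 0 := by
    intro k
    induction k with
    | zero => exact ⟨x, hx, fun i => by simp⟩
    | succ k ih =>
      obtain ⟨y, hy, h⟩ := ih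
      refine ⟨constaShift a y, hK.constaShift_mem hy, fun i => ?_⟩
      have h1 : Fin.ofNat N (k + 1) = 1 + Fin.ofNat N k := by
        apply Fin.ext
        simp [Fin.val_add, add_comm]
      rw [constaShift_apply, h1, ← sub_sub, ← h]
      split_ifs <;> simp [ha]
  obtain ⟨y, hy, h⟩ := key k
  exact ⟨y, hy, by simpa using h⟩

/-- Every constacyclic code is generated by a divisor of `X ^ N - a`. -/
lemma IsConstacyclic.exists_eq_constaCode [NeZero N] {a : F} {K : Submodule F (Fin N → F)}
    (hK : IsConstacyclic a K) : ∃ g : F[X], g ∣ X ^ N - C a ∧ K = constaCode N a g := by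
  have hN : N ≠ 0 := NeZero.ne N
  have hm : (X ^ N - C a : F[X]).Monic := monic_X_pow_sub_C a hN
  have hdeg : ∀ f : F[X], (f %ₘ (X ^ N - C a)).degree < N := fun f =>
    (degree_modByMonic_lt f hm).trans_eq (degree_X_pow_sub_C (Nat.pos_of_ne_zero hN) a)
  have hX : ∀ f : F[X], polyWord N (f %ₘ (X ^ N - C a)) ∈ K →
      polyWord N ((X * f) %ₘ (X ^ N - C a)) ∈ K := by
    intro f hf
    have h1 : constaShift a (polyWord N (f %ₘ (X ^ N - C a))) ∈ K :=
      hK.constaShift_mem hf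
    convert h1 using 1
    set x := polyWord N (f %ₘ (X ^ N - C a)) with hx
    have h2 := wordPoly_constaShift a x
    rw [hx, wordPoly_polyWord (hdeg f), ← hx] at h2
    have h3 : (X * f) %ₘ (X ^ N - C a) = wordPoly (constaShift a x) := by
      refine (div_modByMonic_unique (X * (f /ₘ (X ^ N - C a)) + C (x (Fin.ofNat N (N - 1)))) _ hm
        ⟨?_, ?_⟩).2
      · rw [h2]
        conv_rhs => rw [← modByMonic_add_div f (X ^ N - C a)]
        ring
      · rw [degree_X_pow_sub_C (Nat.pos_of_ne_zero hN) a]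
        exact degree_wordPoly_lt _
    rw [h3, polyWord_wordPoly]
  -- The preimage of `K` under reduction modulo `X ^ N - a`. Stability under the shift is stability
  -- under multiplication by `X`, so this is an ideal, and its generator is the required divisor.
  let I : Ideal F[X] :=
    { carrier := {f | polyWord N (f %ₘ (X ^ N - C a)) ∈ K}
      add_mem' := by
        intro f g hf hg
        simp only [Set.mem_ofPred_eq, add_modByMonic, map_add] at *
        exact K.add_mem hf hg
      zero_mem' := by simp
      smul_mem' := by
        intro q f hf
        simp only [Set.mem_ofPred_eq, smul_eq_mul] at *
        induction q using Polynomial.induction_on' with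
        | add p q hp hq =>
          rw [add_mul, add_modByMonic, map_add]
          exact K.add_mem hp hq
        | monomial n b =>
          induction n with
          | zero =>
            rw [monomial_zero_left, ← smul_eq_C_mul, smul_modByMonic, map_smul]
            exact K.smul_mem _ hf
          | succ n ih =>
            rw [← X_mul_monomial, mul_assoc]
            exact hX _ ih }
  have hI : ∀ f, f ∈ I ↔ polyWord N (f %ₘ (X ^ N - C a)) ∈ K := fun f => Iff.rfl
  obtain ⟨g, hg⟩ := IsPrincipalIdealRing.principal I
  have hg' : ∀ f, f ∈ I ↔ g ∣ f := fun f => by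
    rw [hg]; exact Ideal.mem_span_singleton
  have hgd : g ∣ X ^ N - C a := by
    rw [← hg', hI, (modByMonic_eq_zero_iff_dvd hm).2 dvd_rfl, map_zero]
    exact K.zero_mem
  refine ⟨g, hgd, ?_⟩
  ext c
  rw [mem_constaCode hgd, ← hg', hI, (modByMonic_eq_self_iff hm).2, polyWord_wordPoly]
  rw [degree_X_pow_sub_C (Nat.pos_of_ne_zero hN) a]
  exact degree_wordPoly_lt c

end Words

/-! ### Pair weights -/

section PairWeight

variable {F : Type*} [Field F] {N : ℕ}

open Classical in
/-- The support of a word. -/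
noncomputable def wordSupport (x : Fin N → F) : Finset (Fin N) := Finset.univ.filter fun i => x i ≠ 0

open Classical in
/-- The support of the symbol-pair vector of a word. -/
noncomputable def pairSupport (x : Fin N → F) : Finset (Fin N) :=
  Finset.univ.filter fun i => x i ≠ 0 ∨ x (finRotate N i) ≠ 0

@[simp] lemma mem_wordSupport {x : Fin N → F} {i : Fin N} : i ∈ wordSupport x ↔ x i ≠ 0 := by
  simp [wordSupport]

@[simp] lemma mem_pairSupport {x : Fin N → F} {i : Fin N} :
    i ∈ pairSupport x ↔ x i ≠ 0 ∨ x (finRotate N i) ≠ 0 := by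
  simp only [pairSupport, Finset.mem_filter, Finset.mem_univ, true_and]

lemma wordSupport_subset_pairSupport (x : Fin N → F) : wordSupport x ⊆ pairSupport x := by
  intro i hi
  rw [mem_wordSupport] at hi
  exact mem_pairSupport.2 (Or.inl hi)

lemma pairDist_eq_card_pairSupport (x y : Fin N → F) :
    pairDist x y = (pairSupport (x - y)).card := by
  classical
  simp only [pairDist, hammingDist, pairSupport]
  congr 1
  ext i
  simp only [Finset.mem_filter, Finset.mem_univ, true_and, pairVector, ne_eq, Prod.mk.injEq,
    Pi.sub_apply, sub_eq_zero]
  tauto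

lemma minPairDist_le {K : Submodule F (Fin N → F)} {x : Fin N → F} (hx : x ∈ K) (h0 : x ≠ 0) :
    minPairDist (K : Set (Fin N → F)) ≤ (pairSupport x).card := by
  refine Nat.sInf_le ⟨x, hx, 0, K.zero_mem, h0, ?_⟩
  rw [pairDist_eq_card_pairSupport, sub_zero]

lemma le_minPairDist {K : Submodule F (Fin N → F)} (hK : K ≠ ⊥) {d : ℕ}
    (h : ∀ x ∈ K, x ≠ 0 → d ≤ (pairSupport x).card) :
    d ≤ minPairDist (K : Set (Fin N → F)) := by
  obtain ⟨x, hx, h0⟩ := K.ne_bot_iff.1 hK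
  refine le_csInf ⟨_, x, hx, 0, K.zero_mem, h0, rfl⟩ ?_
  rintro _ ⟨x, hx, y, hy, hxy, rfl⟩
  rw [pairDist_eq_card_pairSupport]
  exact h _ (K.sub_mem hx hy) (sub_ne_zero.2 hxy)

lemma minPairDist_le_length {K : Submodule F (Fin N → F)} (hK : K ≠ ⊥) :
    minPairDist (K : Set (Fin N → F)) ≤ N := by
  obtain ⟨x, hx, h0⟩ := K.ne_bot_iff.1 hK
  exact (minPairDist_le hx h0).trans ((Finset.card_le_univ _).trans_eq (Fintype.card_fin N))

lemma isPairMDS_iff [Finite F] {K : Submodule F (Fin N → F)} (hK : K ≠ ⊥) :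
    IsPairMDS (K : Set (Fin N → F)) ↔
      Module.finrank F K + minPairDist (K : Set (Fin N → F)) = N + 2 := by
  have := minPairDist_le_length hK
  have h1 : Nat.card (K : Set (Fin N → F)) = Nat.card F ^ Module.finrank F K :=
    Module.natCard_eq_pow_finrank (K := F) (V := K)
  rw [IsPairMDS, h1, Nat.pow_right_inj Finite.one_lt_card]
  omega

/-- A word supported on `T + [0, b]` has pair weight at most `|T| (b + 2)`. -/
lemma card_pairSupport_le [NeZero N] (x : Fin N → F) (T : Finset ℕ) (b : ℕ)
    (h : ∀ i, x i ≠ 0 → ∃ t ∈ T, ∃ v ≤ b, (i : ℕ) = t + v) :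
    (pairSupport x).card ≤ T.card * (b + 2) := by
  classical
  -- The interval `[t, t + b]` meets the `b + 2` pairs starting at `t - 1, t, …, t + b`; the value
  -- `b + 1` of the second coordinate encodes the cyclic predecessor of `t`.
  let φ : ℕ × ℕ → Fin N := fun q =>
    if q.2 ≤ b then Fin.ofNat N (q.1 + q.2) else Fin.ofNat N q.1 - 1
  have hsub : pairSupport x ⊆ (T ×ˢ Finset.range (b + 2)).image φ := by
    intro i hi
    rw [Finset.mem_image]
    have key : ∀ t ∈ T, ∀ v ≤ b, (i : ℕ) = t + v →
        ∃ q ∈ T ×ˢ Finset.range (b + 2), φ q = i := by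
      intro t ht v hv e
      refine ⟨(t, v), by simp [ht]; omega, ?_⟩
      simp only [φ, hv, if_true, ← e]
      simp
    rcases mem_pairSupport.1 hi with h1 | h1
    · obtain ⟨t, ht, v, hv, e⟩ := h _ h1
      exact key t ht v hv e
    · rw [finRotate_apply] at h1
      obtain ⟨t, ht, v, hv, e⟩ := h _ h1
      rcases Nat.eq_zero_or_pos v with rfl | hv0
      · refine ⟨(t, b + 1), by simp [ht], ?_⟩
        have : Fin.ofNat N t = i + 1 := by
          rw [add_zero] at e
          rw [← e]; simp
        change (if b + 1 ≤ b then _ else Fin.ofNat N t - 1) = i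
        rw [if_neg (by omega), this, add_sub_cancel_right]
      · refine key t ht (v - 1) (by omega) ?_
        have h2 : ((i + 1 : Fin N) : ℕ) = (i + 1) % N := by
          rw [Fin.val_add, Fin.val_one', Nat.add_mod_mod]
        have h3 : (i : ℕ) + 1 < N := by
          by_contra h4
          have h5 : (i : ℕ) + 1 = N := by have := i.2; omega
          rw [h2, h5, Nat.mod_self] at e
          omega
        rw [h2, Nat.mod_eq_of_lt h3] at e
        omega
  calc (pairSupport x).card ≤ _ := Finset.card_le_card hsub
    _ ≤ _ := Finset.card_image_le
    _ = T.card * (b + 2) := by rw [Finset.card_product, Finset.card_range]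

/-- Walking backwards around the cycle from one nonzero position reaches all of them. -/
lemma wordSupport_eq_univ_of_add_one [NeZero N] {x : Fin N → F} (h0 : x ≠ 0)
    (h : ∀ i, x (i + 1) ≠ 0 → x i ≠ 0) : ∀ i, x i ≠ 0 := by
  obtain ⟨j, hj⟩ := Function.ne_iff.1 h0
  have key : ∀ k : ℕ, x (j - Fin.ofNat N k) ≠ 0 := by
    intro k
    induction k with
    | zero => simpa using hj
    | succ k ih =>
      refine h _ ?_
      have h1 : Fin.ofNat N (k + 1) = Fin.ofNat N k + 1 := by
        apply Fin.ext
        simp [Fin.val_add]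
      rw [h1]
      convert ih using 2
      abel
  intro i
  simpa using key (j - i : Fin N)

/-- The pair weight of a word exceeds its Hamming weight, unless the word has full support. -/
lemma min_card_wordSupport_lt_card_pairSupport [NeZero N] {x : Fin N → F} (h0 : x ≠ 0) :
    min ((wordSupport x).card + 1) N ≤ (pairSupport x).card := by
  by_cases h : ∀ i, x (i + 1) ≠ 0 → x i ≠ 0
  · have h1 : wordSupport x = Finset.univ := by
      ext i
      simp [wordSupport_eq_univ_of_add_one h0 h i]
    have h2 := Finset.card_le_card (wordSupport_subset_pairSupport x)
    rw [h1, Finset.card_univ, Fintype.card_fin] at h2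
    exact (min_le_right _ _).trans h2
  · push Not at h
    obtain ⟨i, h1, h2⟩ := h
    refine (min_le_left _ _).trans (Nat.succ_le_of_lt (Finset.card_lt_card ?_))
    refine (Finset.ssubset_iff_of_subset (wordSupport_subset_pairSupport x)).2 ⟨i, ?_, ?_⟩
    · rw [mem_pairSupport, finRotate_apply]
      exact Or.inr h1
    · simp [h2]

lemma card_wordSupport_eq (x : Fin N → F) :
    (wordSupport x).card = (wordPoly x).support.card := by
  refine Finset.card_bij (fun i _ => (i : ℕ)) ?_ ?_ ?_
  · intro i hi
    simpa using hi
  · intro i _ j _ h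
    exact Fin.ext h
  · intro j hj
    rw [mem_support_iff, wordPoly_coeff] at hj
    split_ifs at hj with h
    · exact ⟨⟨j, h⟩, by simpa using hj, rfl⟩
    · exact absurd rfl hj

/-- A word in a constacyclic code that vanishes cyclically outside of `[k, k + deg g)` is zero. -/
lemma eq_zero_of_vanish_outside_interval [Finite F] [NeZero N] {a : F} (ha : a ≠ 0) {g : F[X]}
    (hg : g ∣ X ^ N - C a) {x : Fin N → F} (hx : x ∈ constaCode N a g) (k : Fin N)
    (h : ∀ i : Fin N, g.natDegree ≤ (i : ℕ) → x (i + k) = 0) : x = 0 := by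
  -- Translating the interval to start at `0` yields a multiple of `g` of degree less than `deg g`.
  obtain ⟨y, hy, hyx⟩ := (isConstacyclic_constaCode ha hg).exists_translate ha hx (-k)
  simp only [sub_neg_eq_add] at hyx
  have hy0 : y = 0 := by
    rw [← wordPoly_eq_zero]
    rw [mem_constaCode hg] at hy
    by_contra h0
    have hd := natDegree_le_of_dvd hy h0
    have hl : (wordPoly y).coeff (wordPoly y).natDegree ≠ 0 := by simpa using h0
    rw [wordPoly_coeff] at hl
    split_ifs at hl with h1
    · exact (hyx _).1 hl (h _ hd)
    · exact hl rfl
  ext i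
  have := hyx (i - k)
  rw [sub_add_cancel, hy0] at this
  simpa using this

/-- Nonzero words of a two-dimensional constacyclic code have full pair weight. -/
lemma card_pairSupport_eq_length [Finite F] [NeZero N] {a : F} (ha : a ≠ 0) {g : F[X]}
    (hg : g ∣ X ^ N - C a) (hd : g.natDegree + 2 = N) {x : Fin N → F}
    (hx : x ∈ constaCode N a g) (h0 : x ≠ 0) : (pairSupport x).card = N := by
  have : pairSupport x = Finset.univ := by
    rw [Finset.eq_univ_iff_forall]
    intro i
    rw [mem_pairSupport, finRotate_apply]
    by_contra! h
    -- A missing pair gives zeros at `i` and `i + 1`; the other positions form an interval of length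
    -- `N - 2 = deg g` starting at `i + 2`.
    refine h0 (eq_zero_of_vanish_outside_interval ha hg hx (i + 1 + 1) fun j hj => ?_)
    have hadd : ∀ l : Fin N, ((l + 1 : Fin N) : ℕ) = (l + 1) % N := fun l => by
      rw [Fin.val_add, Fin.val_one', Nat.add_mod_mod]
    have hj' := j.2
    rcases (show (j : ℕ) + 2 = N ∨ (j : ℕ) + 1 = N by omega) with e | e
    · have e2 : j + 1 + 1 = 0 := by
        apply Fin.ext
        rw [hadd, hadd, Nat.mod_add_mod, add_assoc, e, Nat.mod_self]; rfl
      have e3 : j + (i + 1 + 1) = i := by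
        rw [show j + (i + 1 + 1) = j + 1 + 1 + i by abel, e2, zero_add]
      rw [e3]
      exact h.1
    · have e2 : j + 1 = 0 := by
        apply Fin.ext
        rw [hadd, e, Nat.mod_self]; rfl
      have e3 : j + (i + 1 + 1) = i + 1 := by
        rw [show j + (i + 1 + 1) = j + 1 + (i + 1) by abel, e2, zero_add]
      rw [e3]
      exact h.2
  rw [this, Finset.card_univ, Fintype.card_fin]

end PairWeight

/-! ### Hamming weights of multiples of a polynomial -/

section HammingWeight

variable {F : Type*} [Field F]

lemma isCoprime_X_pow_sub_C_X {n : ℕ} (hn : n ≠ 0) {b : F} (hb : b ≠ 0) :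
    IsCoprime (X ^ n - C b : F[X]) X := by
  refine ⟨-C b⁻¹, C b⁻¹ * X ^ (n - 1), ?_⟩
  have h1 : (X : F[X]) ^ (n - 1) * X = X ^ n := by
    rw [← pow_succ, Nat.sub_add_cancel (Nat.pos_of_ne_zero hn)]
  have h2 : (C b⁻¹ * C b : F[X]) = 1 := by rw [← C_mul, inv_mul_cancel₀ hb, C_1]
  rw [mul_assoc, h1]
  linear_combination h2

lemma not_isUnit_X_pow_sub_C {n : ℕ} (hn : n ≠ 0) (b : F) : ¬ IsUnit (X ^ n - C b : F[X]) := by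
  intro h
  have := natDegree_eq_zero_of_isUnit h
  rw [natDegree_X_pow_sub_C] at this
  exact hn this

/-- A nonzero monomial is a unit times a power of `X`, so no nonunit coprime to `X` divides it. -/
lemma one_lt_card_support_of_dvd {g f : F[X]} (hgX : IsCoprime g X) (hg : ¬ IsUnit g)
    (hf : f ≠ 0) (h : g ∣ f) : 1 < f.support.card := by
  by_contra hc
  obtain ⟨n, a, rfl⟩ := card_support_le_one_iff_monomial.1 (not_lt.1 hc)
  have ha : a ≠ 0 := by rintro rfl; simp at hf
  rw [← C_mul_X_pow_eq_monomial, (isUnit_C.2 ha.isUnit).dvd_mul_left] at h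
  exact hg (hgX.pow_right.isUnit_of_dvd h)

/-- A nonzero multiple of `g ^ i` whose exponents are distinct in `F` has more than `i` terms. -/
lemma lt_card_support_of_pow_dvd {g : F[X]} (hgX : IsCoprime g X) (hg : ¬ IsUnit g) (i : ℕ) :
    ∀ f : F[X], f ≠ 0 → (∀ j ∈ f.support, ∀ k ∈ f.support, (j : F) = k → j = k) → g ^ i ∣ f →
      i < f.support.card := by
  induction i with
  | zero =>
    intro f hf _ _
    exact Finset.card_pos.2 (nonempty_support_iff.2 hf)
  | succ i ih =>
    intro f hf hs hd
    obtain ⟨k, hk⟩ := nonempty_support_iff.2 hf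
    -- The operator `X d/dX - k` removes exactly the term of exponent `k`, because exponents are
    -- distinct in `F`, and costs only one factor `g`.
    have hcoeff : ∀ j : ℕ, (X * derivative f - C (k : F) * f).coeff j = ((j : F) - k) * f.coeff j := by
      intro j
      rcases j with _ | j
      · simp
      · rw [coeff_sub, coeff_X_mul, coeff_derivative, coeff_C_mul]
        push_cast
        ring
    have hsupp : (X * derivative f - C (k : F) * f).support = f.support.erase k := by
      ext j
      rw [mem_support_iff, hcoeff, Finset.mem_erase, mul_ne_zero_iff, sub_ne_zero,
        ← mem_support_iff]
      refine and_congr_left fun hj => not_congr ⟨hs j hj k hk, fun e => by rw [e]⟩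
    have hcard := Finset.card_erase_of_mem hk
    by_cases h0 : X * derivative f - C (k : F) * f = 0
    · have h1 := one_lt_card_support_of_dvd hgX hg hf
        ((dvd_pow_self g (Nat.succ_ne_zero i)).trans hd)
      rw [h0, support_zero] at hsupp
      rw [← hsupp, Finset.card_empty] at hcard
      omega
    · have h1 := ih _ h0 (by
          rw [hsupp]
          exact fun a ha b hb => hs a (Finset.mem_of_mem_erase ha) b (Finset.mem_of_mem_erase hb))
        (dvd_sub ((pow_sub_one_dvd_derivative_of_pow_dvd hd).mul_left _)
          (((pow_dvd_pow g (Nat.le_succ i)).trans hd).mul_left _))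
      rw [hsupp] at h1
      omega

/-- The even part of a multiple of an even polynomial is a multiple of it. -/
lemma exists_even_part {g f : F[X]} (h2 : (2 : F) ≠ 0) (hg : g.comp (C (-1) * X) = g)
    (h : g ∣ f) :
    ∃ e : F[X], g ∣ e ∧ ∀ j, e.coeff j = if Even j then f.coeff j else 0 := by
  refine ⟨C 2⁻¹ * (f + f.comp (C (-1) * X)), Dvd.dvd.mul_left (dvd_add h ?_) _, fun j => ?_⟩
  · obtain ⟨q, rfl⟩ := h
    rw [mul_comp, hg]
    exact dvd_mul_right _ _
  · rw [coeff_C_mul, coeff_add, comp_C_mul_X_coeff]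
    split_ifs with hj
    · rw [hj.neg_one_pow]
      field_simp
      ring
    · rw [(Nat.not_even_iff_odd.1 hj).neg_one_pow]
      simp

end HammingWeight

/-! ### Lower bounds for pair weights -/

section LowerBounds

variable {F : Type*} [Field F] {N : ℕ}

/-- Without adjacent nonzero positions, the support and its translate by `-1` are disjoint, and both
lie in the pair support. -/
lemma two_mul_card_wordSupport_le [NeZero N] {x : Fin N → F}
    (h : ∀ j, x j ≠ 0 → x (j + 1) = 0) : 2 * (wordSupport x).card ≤ (pairSupport x).card := by
  classical
  have hd : Disjoint (wordSupport x) ((wordSupport x).image (· - 1)) := by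
    rw [Finset.disjoint_left]
    intro j hj hj'
    obtain ⟨k, hk, rfl⟩ := Finset.mem_image.1 hj'
    rw [mem_wordSupport] at hj hk
    have := h _ hj
    rw [sub_add_cancel] at this
    exact hk this
  calc 2 * (wordSupport x).card
      = (wordSupport x ∪ (wordSupport x).image (· - 1)).card := by
        rw [Finset.card_union_of_disjoint hd,
          Finset.card_image_of_injective _ (sub_left_injective), two_mul]
    _ ≤ _ := by
      refine Finset.card_le_card (Finset.union_subset (wordSupport_subset_pairSupport x) ?_)
      intro j hj
      obtain ⟨k, hk, rfl⟩ := Finset.mem_image.1 hj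
      rw [mem_wordSupport] at hk
      rw [mem_pairSupport, finRotate_apply]
      right
      simpa using hk

/-- For words of even length in the code of an even polynomial `g`, the pair weight is at least
twice the Hamming weight of the multiples of `g` with exponents of a single parity. -/
lemma two_mul_le_card_pairSupport [NeZero N] (hN : Even N) (h2 : (2 : F) ≠ 0) {g : F[X]}
    (hg : g.comp (C (-1) * X) = g) {d : ℕ}
    (hd : ∀ f : F[X], f ≠ 0 → g ∣ f → f.degree < N →
      (∀ j ∈ f.support, ∀ k ∈ f.support, Even j ↔ Even k) → d ≤ f.support.card)
    {x : Fin N → F} (hx : g ∣ wordPoly x) (h0 : x ≠ 0) : 2 * d ≤ (pairSupport x).card := by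
  have hf0 : wordPoly x ≠ 0 := by rwa [Ne, wordPoly_eq_zero]
  have hparity : ∀ j : Fin N, Even ((j + 1 : Fin N) : ℕ) ↔ ¬ Even (j : ℕ) := by
    intro j
    rw [Fin.val_add, Fin.val_one', Nat.add_mod_mod, ← Nat.even_add_one, Nat.even_iff,
      Nat.even_iff, Nat.mod_mod_of_dvd _ hN.two_dvd]
  have hdeg := degree_wordPoly_lt x
  -- With a single parity and `N` even, nonzero positions are never adjacent, so each counts twice.
  -- Otherwise the even and odd parts are both nonzero multiples of `g`, and the Hamming weight
  -- alone reaches `2 d`.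
  by_cases hpar : ∀ j ∈ (wordPoly x).support, ∀ k ∈ (wordPoly x).support, Even j ↔ Even k
  · have h1 := hd _ hf0 hx hdeg hpar
    rw [← card_wordSupport_eq] at h1
    refine (Nat.mul_le_mul_left 2 h1).trans (two_mul_card_wordSupport_le fun j hj => ?_)
    by_contra hj'
    have := hpar j (by simpa using hj) (j + 1 : Fin N) (by simpa using hj')
    rw [hparity] at this
    tauto
  · obtain ⟨e, hge, he⟩ := exists_even_part h2 hg hx
    have ho : ∀ j, (wordPoly x - e).coeff j = if Even j then 0 else (wordPoly x).coeff j := by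
      intro j
      rw [coeff_sub, he]
      split_ifs <;> simp
    have hes : e.support = (wordPoly x).support.filter Even := by
      ext j
      rw [mem_support_iff, he, Finset.mem_filter, mem_support_iff]
      split_ifs with h <;> simp [h]
    have hos : (wordPoly x - e).support = (wordPoly x).support.filter fun j => ¬ Even j := by
      ext j
      rw [mem_support_iff, ho, Finset.mem_filter, mem_support_iff]
      split_ifs with h <;> simp [h]
    have hcard : (wordPoly x).support.card = e.support.card + (wordPoly x - e).support.card := by
      rw [hes, hos, Finset.card_filter_add_card_filter_not]
    push Not at hpar
    obtain ⟨j, hj, k, hk, hjk⟩ := hpar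
    have hne : e.support.Nonempty ∧ (wordPoly x - e).support.Nonempty := by
      rw [hes, hos]
      rcases hjk with ⟨h1, h2⟩ | ⟨h1, h2⟩
      · exact ⟨⟨j, by simp only [Finset.mem_filter]; exact ⟨hj, h1⟩⟩,
          ⟨k, by simp only [Finset.mem_filter]; exact ⟨hk, h2⟩⟩⟩
      · exact ⟨⟨k, by simp only [Finset.mem_filter]; exact ⟨hk, h2⟩⟩,
          ⟨j, by simp only [Finset.mem_filter]; exact ⟨hj, h1⟩⟩⟩
    have hsub : ∀ q : F[X], q.support ⊆ (wordPoly x).support → q.degree < N := fun q hq =>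
      (degree_mono hq).trans_lt hdeg
    have h3 := hd e (support_nonempty.1 hne.1) hge
      (hsub _ (hes ▸ Finset.filter_subset _ _)) (by
        intro j hj k hk
        rw [hes, Finset.mem_filter] at hj hk
        simp [hj.2, hk.2])
    have h4 := hd (wordPoly x - e) (support_nonempty.1 hne.2) (dvd_sub hx hge)
      (hsub _ (hos ▸ Finset.filter_subset _ _)) (by
        intro j hj k hk
        rw [hos, Finset.mem_filter] at hj hk
        simp only [hj.2, hk.2])
    have h5 := Finset.card_le_card (wordSupport_subset_pairSupport x)
    rw [card_wordSupport_eq] at h5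
    omega

/-- Pair weight below 4 would force a support of two adjacent positions, an interval of length `deg
g`, on which no nonzero codeword can live. -/
lemma four_le_card_pairSupport [Finite F] [NeZero N] (hN : 4 ≤ N) {a : F} (ha : a ≠ 0) {g : F[X]}
    (hg : g ∣ X ^ N - C a) (hgd : g.natDegree = 2) (hgX : IsCoprime g X) {x : Fin N → F}
    (hx : x ∈ constaCode N a g) (h0 : x ≠ 0) : 4 ≤ (pairSupport x).card := by
  classical
  have hf0 : wordPoly x ≠ 0 := by rwa [Ne, wordPoly_eq_zero]
  have hgu : ¬ IsUnit g := fun h => by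
    have := natDegree_eq_zero_of_isUnit h
    omega
  have hw := one_lt_card_support_of_dvd hgX hgu hf0 ((mem_constaCode hg).1 hx)
  rw [← card_wordSupport_eq] at hw
  have hmin := min_card_wordSupport_lt_card_pairSupport h0
  by_contra hlt
  have hw2 : (wordSupport x).card = 2 := by omega
  have hnf : ¬ ∀ i, x (i + 1) ≠ 0 → x i ≠ 0 := by
    intro h
    have h1 : wordSupport x = Finset.univ := by
      ext i
      simp [wordSupport_eq_univ_of_add_one h0 h i]
    rw [h1, Finset.card_univ, Fintype.card_fin] at hw2
    omega
  push Not at hnf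
  obtain ⟨i, hi1, hi⟩ := hnf
  have hsub : insert i (wordSupport x) ⊆ pairSupport x := by
    refine Finset.insert_subset ?_ (wordSupport_subset_pairSupport x)
    rw [mem_pairSupport, finRotate_apply]
    exact Or.inr hi1
  have heq : insert i (wordSupport x) = pairSupport x := by
    refine Finset.eq_of_subset_of_card_le hsub ?_
    rw [Finset.card_insert_of_notMem (by simp [hi])]
    omega
  obtain ⟨w, hw⟩ := Finset.card_eq_one.1 (show ((wordSupport x).erase (i + 1)).card = 1 by
    rw [Finset.card_erase_of_mem (by simpa using hi1)]; omega)
  have hS : ∀ j, x j ≠ 0 → j = i + 1 ∨ j = w := by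
    intro j hj
    by_cases h : j = i + 1
    · exact Or.inl h
    · have : j ∈ (wordSupport x).erase (i + 1) := by simp [h, hj]
      rw [hw, Finset.mem_singleton] at this
      exact Or.inr this
  have hwm : w ∈ (wordSupport x).erase (i + 1) := by simp [hw]
  rw [Finset.mem_erase, mem_wordSupport] at hwm
  have hone : ((1 : Fin N) : ℕ) = 1 := by
    rw [Fin.val_one', Nat.mod_eq_of_lt (by omega)]
  have hw1 : w = i + 1 + 1 := by
    have h1 : w - 1 ∈ insert i (wordSupport x) := by
      rw [heq, mem_pairSupport, finRotate_apply, sub_add_cancel]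
      exact Or.inr hwm.2
    rw [Finset.mem_insert, mem_wordSupport] at h1
    rcases h1 with h1 | h1
    · exact absurd (sub_eq_iff_eq_add.1 h1) hwm.1
    · rcases hS _ h1 with h1 | h1
      · exact sub_eq_iff_eq_add.1 h1
      · rw [sub_eq_self] at h1
        rw [h1] at hone
        exact absurd hone (by simp)
  refine h0 (eq_zero_of_vanish_outside_interval ha hg hx (i + 1) fun j hj => ?_)
  rw [hgd] at hj
  by_contra hne
  rcases hS _ hne with h1 | h1
  · rw [add_eq_right] at h1
    rw [h1] at hj
    simp at hj
  · rw [hw1, add_comm (i + 1), add_left_inj] at h1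
    rw [h1, hone] at hj
    omega

end LowerBounds

/-! ### The exceptional ternary code of length 9 -/

section LengthNine

variable {F : Type*} [Field F]

/-- Unless the support is full, pair weight is Hamming weight plus the number of cyclic runs. At
most 5 leaves one run of length at most 4, or two runs with at most three positions in all. -/
lemma cyclic_nine_pattern : ∀ m : Fin 9 → Bool, (∃ i, m i = true) →
    (Finset.univ.filter fun i => m i = true ∨ m (finRotate 9 i) = true).card ≤ 5 →
    ∃ k : Fin 9, (∀ j : Fin 9, m (j - k) = true → j < 4) ∨
      ∃ t : Fin 9, ∀ j : Fin 9, m (j - k) = true → j = 0 ∨ j = 1 ∨ j = t := by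
  decide +kernel

/-- The Taylor coefficients at `β` of orders 2 and 3 see only the term of exponent `t`, and for each
`t` one of `t.choose 2`, `t.choose 3` is nonzero modulo 3. -/
lemma not_X_sub_C_pow_four_dvd_trinomial (h3 : (3 : F) = 0) {β : F} (hβ : β ≠ 0) (a b : F) {c : F}
    (hc : c ≠ 0) {t : ℕ} (ht : 4 ≤ t) (ht' : t < 9) :
    ¬ (X - C β) ^ 4 ∣ monomial 0 a + monomial 1 b + monomial t c := by
  rintro ⟨q, hq⟩
  have h1 : ∀ n < 4, (taylor β (monomial 0 a + monomial 1 b + monomial t c)).coeff n = 0 := by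
    rw [← X_pow_dvd_iff, hq, taylor_mul, taylor_pow]
    simp [taylor_X, taylor_C]
  have h2 : ∀ n, 2 ≤ n → n < 4 → (t.choose n : F) * c = 0 := by
    intro n hn hn'
    have h := h1 n hn'
    rw [taylor_coeff, map_add, map_add, hasseDeriv_monomial, hasseDeriv_monomial,
      hasseDeriv_monomial, Nat.choose_eq_zero_of_lt (by omega : 0 < n),
      Nat.choose_eq_zero_of_lt (by omega : 1 < n)] at h
    simpa [hβ] using h
  have e2 := h2 2 le_rfl (by norm_num)
  have e3 := h2 3 (by norm_num) (by norm_num)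
  apply hc
  interval_cases t
  · rw [show Nat.choose 4 3 = 4 from rfl] at e3
    push_cast at e3
    linear_combination e3 - c * h3
  · rw [show Nat.choose 5 3 = 10 from rfl] at e3
    push_cast at e3
    linear_combination e3 - 3 * c * h3
  · rw [show Nat.choose 6 3 = 20 from rfl] at e3
    push_cast at e3
    linear_combination -e3 + 7 * c * h3
  · rw [show Nat.choose 7 3 = 35 from rfl] at e3
    push_cast at e3
    linear_combination -e3 + 12 * c * h3
  · rw [show Nat.choose 8 2 = 28 from rfl] at e2
    push_cast at e2
    linear_combination e2 - 9 * c * h3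

lemma six_le_card_pairSupport [Finite F] (h3 : (3 : F) = 0) {a β : F} (ha : a ≠ 0) (hβ : β ≠ 0)
    (hg : (X - C β) ^ 4 ∣ X ^ 9 - C a) {x : Fin 9 → F}
    (hx : x ∈ constaCode 9 a ((X - C β) ^ 4)) (h0 : x ≠ 0) : 6 ≤ (pairSupport x).card := by
  classical
  by_contra hlt
  obtain ⟨i, hi⟩ := Function.ne_iff.1 h0
  obtain ⟨k, hk⟩ := cyclic_nine_pattern (fun i => decide (x i ≠ 0)) ⟨i, by simpa using hi⟩ (by
    simp only [decide_eq_true_eq]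
    have : (pairSupport x).card ≤ 5 := by omega
    convert this using 2
    ext i
    rw [Finset.mem_filter, mem_pairSupport]
    simp)
  simp only [decide_eq_true_eq] at hk
  obtain ⟨y, hy, hyx⟩ := (isConstacyclic_constaCode ha hg).exists_translate ha hx k
  simp only [← hyx] at hk
  have hy0 : wordPoly y ≠ 0 := by
    rw [Ne, wordPoly_eq_zero]
    rintro rfl
    exact (hyx (i + k)).2 (by simpa using hi) rfl
  rw [mem_constaCode hg] at hy
  -- A nonzero multiple of a quartic cannot have degree less than 4; this excludes the one-run
  -- pattern and forces `t ≥ 4` in the other.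
  have hsmall : ¬ ∀ j : Fin 9, y j ≠ 0 → j < 4 := by
    intro h
    have h1 := natDegree_le_of_dvd hy hy0
    rw [natDegree_pow, natDegree_X_sub_C] at h1
    have hl : (wordPoly y).coeff (wordPoly y).natDegree ≠ 0 := by simpa using hy0
    rw [wordPoly_coeff] at hl
    split_ifs at hl with h2
    · have h3 := h _ hl
      rw [Fin.lt_def] at h3
      change (wordPoly y).natDegree < 4 at h3
      omega
    · exact hl rfl
  rcases hk with hk | ⟨t, ht⟩
  · exact hsmall hk
  · have ht4 : ¬ t < 4 := fun h => hsmall fun j hj => by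
      rcases ht j hj with rfl | rfl | rfl
      · decide
      · decide
      · exact h
    have hyt : y t ≠ 0 := by
      intro h
      refine hsmall fun j hj => ?_
      rcases ht j hj with rfl | rfl | rfl
      · decide
      · decide
      · exact absurd h hj
    have ht4' : 4 ≤ (t : ℕ) := by
      rw [not_lt, Fin.le_def] at ht4
      exact ht4
    refine not_X_sub_C_pow_four_dvd_trinomial h3 hβ (y 0) (y 1) hyt ht4' t.2 ?_
    convert hy using 1
    ext j
    simp only [coeff_add, coeff_monomial]
    by_cases h1 : j = 0
    · subst h1
      have : (t : ℕ) ≠ 0 := by omega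
      simp [wordPoly_coeff, this]
    by_cases h2 : j = 1
    · subst h2
      have : (t : ℕ) ≠ 1 := by omega
      simp [wordPoly_coeff, this]
    by_cases h4 : j = t
    · subst h4
      simp [Ne.symm h1, Ne.symm h2]
    rw [if_neg (Ne.symm h1), if_neg (Ne.symm h2), if_neg (Ne.symm h4), wordPoly_coeff]
    split_ifs with h5
    · by_contra hne
      rw [add_zero, add_zero] at hne
      rcases ht _ (Ne.symm hne) with e | e | e
      · exact h1 (congrArg Fin.val e)
      · exact h2 (congrArg Fin.val e)
      · exact h4 (congrArg Fin.val e)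
    · simp

end LengthNine

/-! ### Words of small pair weight -/

section SmallWords

variable {F : Type*} [Field F]

lemma exists_of_coeff_mul_ne_zero {f g : F[X]} {j : ℕ} (h : (f * g).coeff j ≠ 0) :
    ∃ u v, f.coeff u ≠ 0 ∧ g.coeff v ≠ 0 ∧ j = u + v := by
  rw [coeff_mul] at h
  obtain ⟨⟨u, v⟩, hm, hne⟩ := Finset.exists_ne_zero_of_sum_ne_zero h
  exact ⟨u, v, left_ne_zero_of_mul hne, right_ne_zero_of_mul hne,
    (Finset.HasAntidiagonal.mem_antidiagonal.1 hm).symm⟩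

lemma exists_of_coeff_X_pow_sub_C_pow_ne_zero {k : ℕ} (hk : k ≠ 0) (b : F) (a : ℕ) {j : ℕ}
    (h : ((X ^ k - C b : F[X]) ^ a).coeff j ≠ 0) : ∃ u ≤ a, j = k * u := by
  have h1 : (X ^ k - C b : F[X]) ^ a = expand F k ((X - C b) ^ a) := by simp
  rw [h1, coeff_expand (Nat.pos_of_ne_zero hk)] at h
  split_ifs at h with hd
  · obtain ⟨u, rfl⟩ := hd
    rw [Nat.mul_div_cancel_left _ (Nat.pos_of_ne_zero hk)] at h
    refine ⟨u, ?_, rfl⟩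
    have := le_natDegree_of_ne_zero h
    rwa [natDegree_pow, natDegree_X_sub_C, mul_one] at this
  · exact absurd rfl h

/-- A multiple of `g` of degree less than `N` with exponents in `T + [0, b]` bounds the minimum
pair distance of the code of `g`. -/
lemma minPairDist_constaCode_le {N : ℕ} [NeZero N] {a : F} {g f : F[X]} (hg : g ∣ X ^ N - C a)
    (hf : f.degree < N) (h0 : f ≠ 0) (hgf : g ∣ f) (T : Finset ℕ) (b : ℕ)
    (h : ∀ j, f.coeff j ≠ 0 → ∃ t ∈ T, ∃ v ≤ b, j = t + v) :
    minPairDist (constaCode N a g : Set (Fin N → F)) ≤ T.card * (b + 2) :=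
  (minPairDist_le (polyWord_mem_constaCode hg hf hgf) (polyWord_ne_zero hf h0)).trans
    (card_pairSupport_le _ T b fun i hi => h i hi)

end SmallWords

/-! ### Codes generated by powers of `X ^ n - b` in characteristic `p` -/

section IrreducibleCase

variable {F : Type*} [Field F] {p : ℕ} [Fact p.Prime] [CharP F p]

lemma X_pow_sub_C_pow_char_pow (n e : ℕ) (b : F) :
    (X ^ n - C b : F[X]) ^ p ^ e = X ^ (n * p ^ e) - C (b ^ p ^ e) := by
  rw [sub_pow_char_pow, ← pow_mul, C_pow]

variable {n s i : ℕ} {b : F}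

lemma X_pow_sub_C_pow_dvd (n : ℕ) (b : F) (hi : i ≤ p ^ s) :
    (X ^ n - C b : F[X]) ^ i ∣ X ^ (n * p ^ s) - C (b ^ p ^ s) := by
  rw [← X_pow_sub_C_pow_char_pow]
  exact pow_dvd_pow _ hi

omit [Fact p.Prime] [CharP F p] in
lemma natDegree_X_pow_sub_C_pow (n i : ℕ) (b : F) :
    ((X ^ n - C b : F[X]) ^ i).natDegree = n * i := by
  rw [natDegree_pow, natDegree_X_pow_sub_C, mul_comm]

lemma finrank_constaCode_pow (hn : n ≠ 0) (b : F) (hi : i ≤ p ^ s) :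
    Module.finrank F (constaCode (n * p ^ s) (b ^ p ^ s) ((X ^ n - C b) ^ i)) =
      n * (p ^ s - i) := by
  rw [finrank_constaCode (X_pow_sub_C_pow_dvd n b hi)
    (pow_ne_zero _ (X_pow_sub_C_ne_zero (Nat.pos_of_ne_zero hn) b)), natDegree_X_pow_sub_C_pow,
    Nat.mul_sub]
  rw [natDegree_X_pow_sub_C_pow]
  exact Nat.mul_le_mul_left n hi

lemma constaCode_pow_ne_bot (hn : n ≠ 0) (b : F) (hi : i < p ^ s) :
    constaCode (n * p ^ s) (b ^ p ^ s) ((X ^ n - C b) ^ i) ≠ ⊥ := by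
  intro h
  have h1 := finrank_constaCode_pow hn b hi.le
  rw [h, finrank_bot, eq_comm, Nat.mul_eq_zero] at h1
  omega

lemma constaCode_pow_ne_top (hn : n ≠ 0) (b : F) (hi0 : 1 ≤ i) (hi : i < p ^ s) :
    constaCode (n * p ^ s) (b ^ p ^ s) ((X ^ n - C b) ^ i) ≠ ⊤ := by
  intro h
  have h1 := finrank_constaCode_pow hn b hi.le
  rw [h, finrank_top, Module.finrank_fin_fun, Nat.mul_right_inj hn] at h1
  omega

lemma isPairMDS_constaCode_pow_iff [Finite F] (hn : n ≠ 0) (b : F) (hi : i < p ^ s) :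
    IsPairMDS (constaCode (n * p ^ s) (b ^ p ^ s) ((X ^ n - C b) ^ i) :
      Set (Fin (n * p ^ s) → F)) ↔
    minPairDist (constaCode (n * p ^ s) (b ^ p ^ s) ((X ^ n - C b) ^ i) :
      Set (Fin (n * p ^ s) → F)) = n * i + 2 := by
  rw [isPairMDS_iff (constaCode_pow_ne_bot hn b hi), finrank_constaCode_pow hn b hi.le,
    Nat.mul_sub]
  have := Nat.mul_le_mul_left n hi.le
  omega

lemma neZero_length (hn : n ≠ 0) : NeZero (n * p ^ s) :=
  ⟨mul_ne_zero hn (pow_ne_zero _ (Fact.out : p.Prime).ne_zero)⟩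

omit [Fact p.Prime] [CharP F p] in
lemma degree_lt_length {j : ℕ} (hn : n ≠ 0) (b : F) (hj : j < p ^ s) :
    ((X ^ n - C b : F[X]) ^ j).degree < (n * p ^ s : ℕ) := by
  rw [← natDegree_lt_iff_degree_lt
    (pow_ne_zero _ (X_pow_sub_C_ne_zero (Nat.pos_of_ne_zero hn) b)), natDegree_X_pow_sub_C_pow]
  exact Nat.mul_lt_mul_of_pos_left hj (Nat.pos_of_ne_zero hn)

/-- A Singleton-attaining lower bound for the pair weights determines all parameters. -/
lemma constaCode_pow_parameters [Finite F] (hn : n ≠ 0) (hb : b ≠ 0) (hi0 : 1 ≤ i)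
    (hi : i < p ^ s)
    (hlow : ∀ x ∈ constaCode (n * p ^ s) (b ^ p ^ s) ((X ^ n - C b) ^ i), x ≠ 0 →
      n * i + 2 ≤ (pairSupport x).card) :
    let K := constaCode (n * p ^ s) (b ^ p ^ s) ((X ^ n - C b) ^ i)
    IsConstacyclic (b ^ p ^ s) K ∧ K ≠ ⊥ ∧ K ≠ ⊤ ∧ Module.finrank F K = n * (p ^ s - i) ∧
      minPairDist (K : Set (Fin (n * p ^ s) → F)) = n * i + 2 ∧
      IsPairMDS (K : Set (Fin (n * p ^ s) → F)) := by
  have := neZero_length (p := p) (s := s) hn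
  have hd := X_pow_sub_C_pow_dvd n b hi.le
  have hbot := constaCode_pow_ne_bot hn b hi
  have hdist : minPairDist (constaCode (n * p ^ s) (b ^ p ^ s) ((X ^ n - C b) ^ i) :
      Set (Fin (n * p ^ s) → F)) = n * i + 2 := by
    refine le_antisymm ?_ (le_minPairDist hbot hlow)
    -- The generator itself, supported on `[0, n i]`, attains the bound.
    refine (minPairDist_constaCode_le hd (degree_lt_length hn b hi)
      (pow_ne_zero _ (X_pow_sub_C_ne_zero (Nat.pos_of_ne_zero hn) b)) dvd_rfl {0} (n * i)
      fun j hj => ⟨0, by simp, j, ?_, by simp⟩).trans_eq (by simp)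
    rw [← natDegree_X_pow_sub_C_pow n i b]
    exact le_natDegree_of_ne_zero hj
  exact ⟨isConstacyclic_constaCode (pow_ne_zero _ hb) hd, hbot, constaCode_pow_ne_top hn b hi0 hi,
    finrank_constaCode_pow hn b hi.le, hdist, (isPairMDS_constaCode_pow_iff hn b hi).2 hdist⟩

/-! ### Upper bounds for the minimum pair distance -/

/-- The generator has at most `i + 1` terms, each meeting two pairs. -/
lemma minPairDist_constaCode_pow_le (hn : n ≠ 0) (b : F) (hi : i < p ^ s) :
    minPairDist (constaCode (n * p ^ s) (b ^ p ^ s) ((X ^ n - C b) ^ i) :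
      Set (Fin (n * p ^ s) → F)) ≤ 2 * (i + 1) := by
  have := neZero_length (p := p) (s := s) hn
  refine (minPairDist_constaCode_le (X_pow_sub_C_pow_dvd n b hi.le) (degree_lt_length hn b hi)
    (pow_ne_zero _ (X_pow_sub_C_ne_zero (Nat.pos_of_ne_zero hn) b)) dvd_rfl
    ((Finset.range (i + 1)).image (n * ·)) 0 fun j hj => ?_).trans ?_
  · obtain ⟨u, hu, rfl⟩ := exists_of_coeff_X_pow_sub_C_pow_ne_zero hn b i hj
    exact ⟨n * u, Finset.mem_image_of_mem _ (by simpa using by omega), 0, le_rfl, rfl⟩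
  · have := Finset.card_image_le (s := Finset.range (i + 1)) (f := (n * ·))
    rw [Finset.card_range] at this
    omega

/-- By Frobenius the power factors as `(X ^ (n p ^ e) - b ^ p ^ e) ^ c * (X ^ n - b) ^ v`. -/
lemma exists_of_coeff_X_pow_sub_C_pow_add_ne_zero (hn : n ≠ 0) (b : F) {e c v j : ℕ}
    (h : ((X ^ n - C b : F[X]) ^ (p ^ e * c + v)).coeff j ≠ 0) :
    ∃ u ≤ c, ∃ w ≤ v, j = n * p ^ e * u + n * w := by
  rw [pow_add, pow_mul, X_pow_sub_C_pow_char_pow] at h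
  obtain ⟨j₁, j₂, h₁, h₂, rfl⟩ := exists_of_coeff_mul_ne_zero h
  have := (neZero_length (p := p) (s := e) hn).out
  obtain ⟨u, hu, rfl⟩ := exists_of_coeff_X_pow_sub_C_pow_ne_zero this _ _ h₁
  obtain ⟨w, hw, rfl⟩ := exists_of_coeff_X_pow_sub_C_pow_ne_zero hn _ _ h₂
  exact ⟨u, hu, w, hw, rfl⟩

lemma minPairDist_constaCode_pow_le_two_mul (hn : n ≠ 0) (b : F) {e c v : ℕ}
    (hi : i ≤ p ^ e * c + v) (hc : p ^ e * c + v < p ^ s) :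
    minPairDist (constaCode (n * p ^ s) (b ^ p ^ s) ((X ^ n - C b) ^ i) :
      Set (Fin (n * p ^ s) → F)) ≤ 2 * ((c + 1) * (v + 1)) := by
  have := neZero_length (p := p) (s := s) hn
  let φ : ℕ × ℕ → ℕ := fun q => n * p ^ e * q.1 + n * q.2
  refine (minPairDist_constaCode_le (X_pow_sub_C_pow_dvd n b (hi.trans hc.le))
    (degree_lt_length hn b hc)
    (pow_ne_zero _ (X_pow_sub_C_ne_zero (Nat.pos_of_ne_zero hn) b)) (pow_dvd_pow _ hi)
    ((Finset.range (c + 1) ×ˢ Finset.range (v + 1)).image φ) 0 fun j hj => ?_).trans ?_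
  · obtain ⟨u, hu, w, hw, rfl⟩ := exists_of_coeff_X_pow_sub_C_pow_add_ne_zero hn b hj
    exact ⟨_, Finset.mem_image.2 ⟨(u, w), by simp; omega, rfl⟩, 0, le_rfl, rfl⟩
  · have := Finset.card_image_le (s := Finset.range (c + 1) ×ˢ Finset.range (v + 1)) (f := φ)
    rw [Finset.card_product, Finset.card_range, Finset.card_range] at this
    omega

/-- For `n = 1` the exponents fill `c + 1` intervals of length `v + 1`, each meeting `v + 2` pairs;
this beats counting isolated terms. -/
lemma minPairDist_constaCode_X_sub_C_pow_le (b : F) {e c v : ℕ}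
    (hi : i ≤ p ^ e * c + v) (hc : p ^ e * c + v < p ^ s) :
    minPairDist (constaCode (1 * p ^ s) (b ^ p ^ s) ((X ^ 1 - C b) ^ i) :
      Set (Fin (1 * p ^ s) → F)) ≤ (c + 1) * (v + 2) := by
  have := neZero_length (p := p) (s := s) one_ne_zero
  refine (minPairDist_constaCode_le (X_pow_sub_C_pow_dvd 1 b (hi.trans hc.le))
    (degree_lt_length one_ne_zero b hc)
    (pow_ne_zero _ (X_pow_sub_C_ne_zero one_pos b)) (pow_dvd_pow _ hi)
    ((Finset.range (c + 1)).image (1 * p ^ e * ·)) v fun j hj => ?_).trans ?_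
  · obtain ⟨u, hu, w, hw, rfl⟩ := exists_of_coeff_X_pow_sub_C_pow_add_ne_zero one_ne_zero b hj
    exact ⟨_, Finset.mem_image_of_mem _ (by simpa using by omega), w, hw, by rw [one_mul w]⟩
  · have := Finset.card_image_le (s := Finset.range (c + 1)) (f := (1 * p ^ e * ·))
    rw [Finset.card_range] at this
    exact Nat.mul_le_mul_right _ this

/-! ### Codes that are not MDS -/

lemma exists_mul_ceil {P : ℕ} (hP : 0 < P) (hi : 1 ≤ i) : ∃ a, P * a + 1 ≤ i ∧ i ≤ P * (a + 1) := by
  refine ⟨(i - 1) / P, ?_, ?_⟩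
  · have := Nat.mul_div_le (i - 1) P
    omega
  · have := Nat.lt_mul_div_succ (i - 1) hP
    omega

lemma minPairDist_lt_of_two (b : F) (hs : 2 ≤ s) (hi : 2 ≤ i) (hi' : i + 2 ≤ p ^ s) :
    minPairDist (constaCode (2 * p ^ s) (b ^ p ^ s) ((X ^ 2 - C b) ^ i) :
      Set (Fin (2 * p ^ s) → F)) < 2 * i + 2 := by
  have hp := (Fact.out : p.Prime).two_le
  obtain ⟨R, hR⟩ : ∃ R, p ^ (s - 1) = R + 2 := by
    refine ⟨p ^ (s - 1) - 2, ?_⟩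
    have := hp.trans (Nat.le_self_pow (by omega : s - 1 ≠ 0) p)
    omega
  have hQ : p ^ s = p * (R + 2) := by
    rw [← hR, ← pow_succ', Nat.sub_add_cancel (by omega)]
  -- Up to `p ^ s - p`, round `i` up to a multiple of `p` and use a power of `X ^ (2 p) - b ^ p`.
  -- Beyond that, use the generator itself, with `v ≤ p - 2`.
  by_cases h : i ≤ p * (R + 1)
  · obtain ⟨a, ha, ha'⟩ := exists_mul_ceil (by omega : 0 < p) (by omega : 1 ≤ i)
    have haR : a < R + 1 := by
      by_contra hcon
      have := Nat.mul_le_mul_left p (not_lt.1 hcon)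
      omega
    refine (minPairDist_constaCode_pow_le_two_mul two_ne_zero b (e := 1) (c := a + 1) (v := 0)
      (by simpa using ha') ?_).trans_lt ?_
    · rw [hQ, pow_one, add_zero]
      exact Nat.mul_lt_mul_of_pos_left (by omega) (by omega)
    · have := Nat.mul_le_mul_right a hp
      omega
  · obtain ⟨v, rfl⟩ := Nat.exists_eq_add_of_le (not_le.1 h).le
    have hv : v + 2 ≤ p := by rw [hQ] at hi'; nlinarith
    refine (minPairDist_constaCode_pow_le_two_mul two_ne_zero b (e := 1) (c := R + 1) (v := v)
      (by simp) ?_).trans_lt ?_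
    · rw [hQ, pow_one]; nlinarith
    · nlinarith

lemma exceptional_of_minPairDist (b : F) {e : ℕ} (hes : e < s) (hP : 3 ≤ p ^ e) (hi : 3 ≤ i)
    (hi' : i + 3 ≤ p ^ s)
    (hd : minPairDist (constaCode (1 * p ^ s) (b ^ p ^ s) ((X ^ 1 - C b) ^ i) :
      Set (Fin (1 * p ^ s) → F)) = i + 2) : p ^ e = 3 ∧ i = 4 := by
  have hp := (Fact.out : p.Prime).two_le
  obtain ⟨R, hR⟩ : ∃ R, p ^ (s - e) = R + 2 := by
    refine ⟨p ^ (s - e) - 2, ?_⟩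
    have := hp.trans (Nat.le_self_pow (by omega : s - e ≠ 0) p)
    omega
  have hQ : p ^ s = p ^ e * (R + 2) := by
    rw [← hR, ← pow_add, Nat.add_sub_cancel' hes.le]
  have hle := fun c v => minPairDist_constaCode_X_sub_C_pow_le (i := i) (s := s) b (e := e)
    (c := c) (v := v)
  rw [hd, hQ] at hle
  rw [hQ] at hi'
  generalize p ^ e = P at *
  by_cases h : i ≤ P * (R + 1)
  · obtain ⟨a, ha, ha'⟩ := exists_mul_ceil (by omega : 0 < P) (by omega : 1 ≤ i)
    have haR : a < R + 1 := by
      by_contra hcon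
      have := Nat.mul_le_mul_left P (not_lt.1 hcon)
      omega
    have h1 := hle (a + 1) 0 (by simpa using ha') (by
      rw [add_zero]
      exact Nat.mul_lt_mul_of_pos_left (by omega) (by omega))
    have h2 := Nat.mul_le_mul_right a hP
    have ha1 : a = 1 := by omega
    subst ha1
    omega
  · exfalso
    obtain ⟨v, rfl⟩ := Nat.exists_eq_add_of_le (not_le.1 h).le
    have hv : v + 3 ≤ P := by nlinarith
    have h1 := hle (R + 1) v le_rfl (by nlinarith)
    nlinarith

/-! ### Classification -/

/-- Nontrivial MDS constacyclic codes are generated by a power of `X ^ n - b`. -/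
lemma IsConstacyclic.exists_eq_constaCode_pow [Finite F] (hn : n ≠ 0)
    (hirr : Irreducible (X ^ n - C b : F[X])) {K : Submodule F (Fin (n * p ^ s) → F)}
    (hK : IsConstacyclic (b ^ p ^ s) K) (hbot : K ≠ ⊥) (htop : K ≠ ⊤) :
    ∃ i, 1 ≤ i ∧ i < p ^ s ∧
      K = constaCode (n * p ^ s) (b ^ p ^ s) ((X ^ n - C b) ^ i) := by
  have := neZero_length (p := p) (s := s) hn
  obtain ⟨g, hg, rfl⟩ := hK.exists_eq_constaCode
  have hg' := hg
  -- Divisors of a prime power are associates of smaller powers; the exponents `0` and `p ^ s` give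
  -- the trivial codes.
  rw [← X_pow_sub_C_pow_char_pow, dvd_prime_pow hirr.prime] at hg'
  obtain ⟨i, hi, hgi⟩ := hg'
  have heq : constaCode (n * p ^ s) (b ^ p ^ s) g =
      constaCode (n * p ^ s) (b ^ p ^ s) ((X ^ n - C b) ^ i) := by
    ext x
    rw [mem_constaCode hg, mem_constaCode (X_pow_sub_C_pow_dvd n b hi), hgi.dvd_iff_dvd_left]
  rw [heq] at hbot htop ⊢
  refine ⟨i, ?_, lt_of_le_of_ne hi ?_, rfl⟩
  · refine Nat.pos_of_ne_zero ?_
    rintro rfl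
    refine htop (eq_top_iff.2 fun x _ => ?_)
    rw [mem_constaCode (by simp)]
    simp
  · rintro rfl
    refine hbot (Submodule.finrank_eq_zero.1 ?_)
    rw [finrank_constaCode_pow hn b le_rfl, Nat.sub_self, mul_zero]

lemma exists_row_of_one (hi0 : 1 ≤ i) (hi : i < p ^ s)
    (hd : minPairDist (constaCode (1 * p ^ s) (b ^ p ^ s) ((X ^ 1 - C b) ^ i) :
      Set (Fin (1 * p ^ s) → F)) = i + 2) :
    ∃ k d, PairMDSTable p s b 1 ((X ^ 1 - C b) ^ i) k d := by
  have hp := (Fact.out : p.Prime).two_le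
  have hle := minPairDist_le_length (constaCode_pow_ne_bot one_ne_zero b hi)
  rw [hd, one_mul] at hle
  have hs0 : s ≠ 0 := by
    rintro rfl
    rw [pow_zero] at hi
    omega
  rw [pow_one]
  by_cases h1 : i = 1
  · subst h1
    rw [pow_one]
    exact ⟨_, _, .row1 (by omega)⟩
  by_cases h2 : i = 2
  · subst h2
    exact ⟨_, _, .row2 (by omega)⟩
  by_cases h3 : i = p ^ s - 2
  · subst h3
    exact ⟨_, _, .row5 (by omega)⟩
  by_cases h4 : s = 1
  · exact ⟨_, _, .row4 i h4 hi0 (by rw [h4, pow_one] at hle; omega)⟩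
  by_cases hp2 : p = 2
  · have hs2 : 2 < s := by
      by_contra hcon
      have : s = 2 := by omega
      rw [hp2, this] at hle h3
      omega
    -- Blocks of length 4, since `p ^ e = 2` is too short; they contradict `p ^ e = 3`.
    have := exceptional_of_minPairDist b hs2 (by rw [hp2]; norm_num) (by omega) (by omega) hd
    rw [hp2] at this
    omega
  · obtain ⟨hp3, rfl⟩ := exceptional_of_minPairDist b (e := 1) (by omega)
      (by rw [pow_one]; omega) (by omega) (by omega) hd
    rw [pow_one] at hp3
    by_cases hs2 : s = 2
    · exact ⟨_, _, .row3 hp3 hs2⟩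
    -- For `s ≥ 3` blocks of length 9 are also available and exclude `i = 4`.
    · have := exceptional_of_minPairDist b (e := 2) (by omega) (by rw [hp3]; norm_num)
        (by omega) (by omega) hd
      rw [hp3] at this
      omega

lemma exists_row_of_two (hs : 1 ≤ s) (hi0 : 1 ≤ i) (hi : i < p ^ s)
    (hd : minPairDist (constaCode (2 * p ^ s) (b ^ p ^ s) ((X ^ 2 - C b) ^ i) :
      Set (Fin (2 * p ^ s) → F)) = 2 * i + 2) :
    ∃ k d, PairMDSTable p s b 2 ((X ^ 2 - C b) ^ i) k d := by
  by_cases h1 : i = 1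
  · subst h1
    rw [pow_one]
    exact ⟨_, _, .row6⟩
  by_cases h3 : i = p ^ s - 1
  · subst h3
    exact ⟨_, _, .row8⟩
  by_cases h4 : s = 1
  · exact ⟨_, _, .row7 i h4 hi0 (by rw [h4, pow_one] at hi h3; omega)⟩
  have := minPairDist_lt_of_two b (by omega : 2 ≤ s) (by omega : 2 ≤ i) (by omega)
  omega

/-! ### The rows of the table -/

/-- In characteristic 2 the derivative vanishes, but irreducible polynomials over a finite field are
separable. -/
lemma two_ne_zero_of_irreducible_X_sq_sub_C [Finite F] (h : Irreducible (X ^ 2 - C b : F[X])) :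
    (2 : F) ≠ 0 := by
  intro h2
  have hsep : (X ^ 2 - C b : F[X]).Separable := PerfectField.separable_of_irreducible h
  have hder : derivative (X ^ 2 - C b : F[X]) = 0 := by
    rw [derivative_sub, derivative_X_pow, derivative_C]
    simp [h2]
  rw [separable_def, hder, isCoprime_zero_right] at hsep
  exact h.not_isUnit hsep

omit [Fact p.Prime] in
lemma natCast_injOn_support {f : F[X]} (hf : f.degree < p) :
    ∀ j ∈ f.support, ∀ k ∈ f.support, (j : F) = k → j = k := by
  intro j hj k hk h
  refine CharP.natCast_injOn_Iio F p ?_ ?_ h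
  · exact Nat.cast_lt.1 ((le_degree_of_mem_supp j hj).trans_lt hf)
  · exact Nat.cast_lt.1 ((le_degree_of_mem_supp k hk).trans_lt hf)

omit [Fact p.Prime] in
-- Chinese remaindering modulo 2 and `p`: a single parity doubles the range of degrees open to the
-- derivative argument.
lemma natCast_injOn_support_of_parity {f : F[X]} (hp : Odd p) (hf : f.degree < (2 * p : ℕ))
    (hpar : ∀ j ∈ f.support, ∀ k ∈ f.support, Even j ↔ Even k) :
    ∀ j ∈ f.support, ∀ k ∈ f.support, (j : F) = k → j = k := by
  intro j hj k hk h
  have h1 : j < 2 * p := Nat.cast_lt.1 ((le_degree_of_mem_supp j hj).trans_lt hf)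
  have h2 : k < 2 * p := Nat.cast_lt.1 ((le_degree_of_mem_supp k hk).trans_lt hf)
  have h3 : j ≡ k [MOD p] := (CharP.natCast_eq_natCast F p).1 h
  have h4 : j ≡ k [MOD 2] := by
    have := hpar j hj k hk
    rw [Nat.even_iff, Nat.even_iff] at this
    unfold Nat.ModEq
    omega
  have h5 := (Nat.modEq_and_modEq_iff_modEq_mul (Nat.coprime_two_left.2 hp)).1 ⟨h4, h3⟩
  exact Nat.ModEq.eq_of_lt_of_lt h5 h1 h2

/-- Each row is reduced to an exponent `i` and a lower bound on pair weights, the input of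
`constaCode_pow_parameters`. -/
lemma parameters_of_one [Finite F] (hb : b ≠ 0) {k d : ℕ} {g : F[X]}
    (h : PairMDSTable p s b 1 g k d) :
    ∃ i, 1 ≤ i ∧ i < p ^ s ∧ g = (X ^ 1 - C b) ^ i ∧ k = 1 * (p ^ s - i) ∧ d = 1 * i + 2 ∧
      ∀ x ∈ constaCode (1 * p ^ s) (b ^ p ^ s) ((X ^ 1 - C b) ^ i), x ≠ 0 →
        1 * i + 2 ≤ (pairSupport x).card := by
  have := neZero_length (p := p) (s := s) one_ne_zero
  have hbs : b ^ p ^ s ≠ 0 := pow_ne_zero _ hb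
  have hgX : IsCoprime (X ^ 1 - C b : F[X]) X := isCoprime_X_pow_sub_C_X one_ne_zero hb
  have hgu : ¬ IsUnit (X ^ 1 - C b : F[X]) := not_isUnit_X_pow_sub_C one_ne_zero b
  cases h with
  | row1 h =>
    refine ⟨1, le_rfl, by omega, by simp, by simp, by simp, fun x hx h0 => ?_⟩
    rw [mem_constaCode (X_pow_sub_C_pow_dvd 1 b (by omega)), pow_one (X ^ 1 - C b)] at hx
    have h1 := one_lt_card_support_of_dvd hgX hgu (by rwa [Ne, wordPoly_eq_zero]) hx
    have h2 := min_card_wordSupport_lt_card_pairSupport h0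
    rw [card_wordSupport_eq] at h2
    omega
  | row2 h =>
    refine ⟨2, by omega, by omega, by simp, by simp, by simp, fun x hx h0 => ?_⟩
    exact four_le_card_pairSupport (by omega) hbs (X_pow_sub_C_pow_dvd 1 b (by omega))
      (natDegree_X_pow_sub_C_pow 1 2 b) hgX.pow_left hx h0
  | row3 hp hs =>
    subst hp hs
    refine ⟨4, by omega, by omega, by simp, by simp, by simp, fun x hx h0 => ?_⟩
    have h3 : (3 : F) = 0 := by exact_mod_cast CharP.cast_eq_zero F 3
    have hd := X_pow_sub_C_pow_dvd (p := 3) (s := 2) (i := 4) 1 b (by omega)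
    rw [pow_one X] at hx hd
    exact six_le_card_pairSupport h3 hbs hb hd hx h0
  | row4 k hs hk hk' =>
    subst hs
    have hps := pow_one p
    refine ⟨k, hk, by omega, by simp, by omega, by omega, fun x hx h0 => ?_⟩
    rw [mem_constaCode (X_pow_sub_C_pow_dvd 1 b (by omega))] at hx
    have hdeg := degree_wordPoly_lt x
    have h1 := lt_card_support_of_pow_dvd hgX hgu k _ (by rwa [Ne, wordPoly_eq_zero])
      (natCast_injOn_support (p := p) (hdeg.trans_eq (by rw [one_mul, pow_one]))) hx
    have h2 := min_card_wordSupport_lt_card_pairSupport h0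
    rw [card_wordSupport_eq] at h2
    omega
  | row5 h =>
    refine ⟨p ^ s - 2, by omega, by omega, by simp, by omega, by omega, fun x hx h0 => ?_⟩
    rw [card_pairSupport_eq_length hbs (X_pow_sub_C_pow_dvd 1 b (by omega))
      (by rw [natDegree_X_pow_sub_C_pow]; omega) hx h0]
    omega

lemma parameters_of_two [Finite F] (hb : b ≠ 0) (hirr : Irreducible (X ^ 2 - C b : F[X]))
    (hs : 1 ≤ s) {k d : ℕ} {g : F[X]} (h : PairMDSTable p s b 2 g k d) :
    ∃ i, 1 ≤ i ∧ i < p ^ s ∧ g = (X ^ 2 - C b) ^ i ∧ k = 2 * (p ^ s - i) ∧ d = 2 * i + 2 ∧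
      ∀ x ∈ constaCode (2 * p ^ s) (b ^ p ^ s) ((X ^ 2 - C b) ^ i), x ≠ 0 →
        2 * i + 2 ≤ (pairSupport x).card := by
  have := neZero_length (p := p) (s := s) two_ne_zero
  have hp := (Fact.out : p.Prime)
  have hps : p ≤ p ^ s := Nat.le_self_pow (by omega) p
  have hp2 := hp.two_le
  have hbs : b ^ p ^ s ≠ 0 := pow_ne_zero _ hb
  have hgX : IsCoprime (X ^ 2 - C b : F[X]) X := isCoprime_X_pow_sub_C_X two_ne_zero hb
  have h2 := two_ne_zero_of_irreducible_X_sq_sub_C hirr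
  have hodd : Odd p := hp.odd_of_ne_two fun e => h2 (by
    subst e; exact_mod_cast CharP.cast_eq_zero F 2)
  have hcomp : ∀ i, ((X ^ 2 - C b : F[X]) ^ i).comp (C (-1) * X) = (X ^ 2 - C b) ^ i := by
    intro i
    simp
  cases h with
  | row6 =>
    refine ⟨1, le_rfl, by omega, by simp, by omega, by simp, fun x hx h0 => ?_⟩
    rw [mem_constaCode (X_pow_sub_C_pow_dvd 2 b (by omega))] at hx
    refine two_mul_le_card_pairSupport (d := 2) (even_two_mul _) h2 (hcomp 1) ?_ hx h0
    intro f hf hd _ _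
    rw [pow_one] at hd
    exact one_lt_card_support_of_dvd hgX hirr.not_isUnit hf hd
  | row7 k hs hk hk' =>
    subst hs
    refine ⟨k, hk, by omega, by simp, by rw [pow_one]; omega, by simp, fun x hx h0 => ?_⟩
    rw [mem_constaCode (X_pow_sub_C_pow_dvd 2 b (by omega))] at hx
    refine two_mul_le_card_pairSupport (d := k + 1) (even_two_mul _) h2 (hcomp k) ?_ hx h0
    intro f hf hd hdeg hpar
    rw [pow_one p] at hdeg
    exact lt_card_support_of_pow_dvd hgX hirr.not_isUnit k f hf
      (natCast_injOn_support_of_parity hodd hdeg hpar) hd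
  | row8 =>
    refine ⟨p ^ s - 1, by omega, by omega, by simp, by omega, by omega, fun x hx h0 => ?_⟩
    rw [card_pairSupport_eq_length hbs (X_pow_sub_C_pow_dvd 2 b (by omega))
      (by rw [natDegree_X_pow_sub_C_pow]; omega) hx h0]
    omega

end IrreducibleCase

theorem mainTheorem2 {F : Type*} [Field F] [Fintype F] (p m n s : ℕ) (hp : p.Prime)
    (hm : 1 ≤ m) (hF : Fintype.card F = p ^ m) (hn : 1 ≤ n) (hs : 1 ≤ s)
    (α₀ α : F) (hα₀ : α₀ ≠ 0) (hα : α = α₀ ^ p ^ s)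
    (hirr : Irreducible (X ^ n - C α₀ : F[X])) :
    (∀ K : Submodule F (Fin (n * p ^ s) → F),
      IsConstacyclic α K → K ≠ ⊥ → K ≠ ⊤ → IsPairMDS (K : Set (Fin (n * p ^ s) → F)) →
        ∃ (g : F[X]) (k d : ℕ), PairMDSTable p s α₀ n g k d ∧ K = constaCode (n * p ^ s) α g) ∧
    (∀ (g : F[X]) (k d : ℕ), PairMDSTable p s α₀ n g k d →
      IsConstacyclic α (constaCode (n * p ^ s) α g) ∧
      constaCode (n * p ^ s) α g ≠ ⊥ ∧ constaCode (n * p ^ s) α g ≠ ⊤ ∧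
      Module.finrank F (constaCode (n * p ^ s) α g) = k ∧
      minPairDist (constaCode (n * p ^ s) α g : Set (Fin (n * p ^ s) → F)) = d ∧
      IsPairMDS (constaCode (n * p ^ s) α g : Set (Fin (n * p ^ s) → F))) ∧
    (3 ≤ n → ¬ ∃ K : Submodule F (Fin (n * p ^ s) → F),
      IsConstacyclic α K ∧ K ≠ ⊥ ∧ K ≠ ⊤ ∧ IsPairMDS (K : Set (Fin (n * p ^ s) → F))) := by
  have : Fact p.Prime := ⟨hp⟩
  have : CharP F p := charP_of_card_eq_prime_pow hF
  have hn0 : n ≠ 0 := by omega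
  subst hα
  have hclass : ∀ K : Submodule F (Fin (n * p ^ s) → F),
      IsConstacyclic (α₀ ^ p ^ s) K → K ≠ ⊥ → K ≠ ⊤ →
        IsPairMDS (K : Set (Fin (n * p ^ s) → F)) →
        ∃ (g : F[X]) (k d : ℕ), PairMDSTable p s α₀ n g k d ∧
          K = constaCode (n * p ^ s) (α₀ ^ p ^ s) g := by
    intro K hK hbot htop hmds
    obtain ⟨i, hi0, hi, rfl⟩ := hK.exists_eq_constaCode_pow hn0 hirr hbot htop
    have hd := (isPairMDS_constaCode_pow_iff hn0 α₀ hi).1 hmds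
    have hle := minPairDist_constaCode_pow_le hn0 α₀ hi
    -- Comparing `n i + 2` with `2 (i + 1)`, where `i ≥ 1`.
    have hn2 : n ≤ 2 := by
      by_contra hcon
      have := Nat.mul_le_mul_right i (not_le.1 hcon)
      omega
    obtain rfl | rfl : n = 1 ∨ n = 2 := by omega
    · obtain ⟨k, d, h⟩ := exists_row_of_one hi0 hi (by rw [hd, one_mul])
      exact ⟨_, k, d, h, rfl⟩
    · obtain ⟨k, d, h⟩ := exists_row_of_two hs hi0 hi hd
      exact ⟨_, k, d, h, rfl⟩
  refine ⟨hclass, fun g k d h => ?_, fun hn3 => ?_⟩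
  · have hn12 : n = 1 ∨ n = 2 := by cases h <;> simp
    rcases hn12 with rfl | rfl
    · obtain ⟨i, hi0, hi, rfl, rfl, rfl, hlow⟩ := parameters_of_one hα₀ h
      exact constaCode_pow_parameters hn0 hα₀ hi0 hi hlow
    · obtain ⟨i, hi0, hi, rfl, rfl, rfl, hlow⟩ := parameters_of_two hα₀ hirr hs h
      exact constaCode_pow_parameters hn0 hα₀ hi0 hi hlow
  · rintro ⟨K, hK, hbot, htop, hmds⟩
    obtain ⟨g, k, d, h, -⟩ := hclass K hK hbot htop hmds
    cases h <;> omega
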